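/- Let $n\in\mathbb{N}$, let $\mathbb{S}^n$ be the space of real symmetric $n\times n$ matrices, and let $\lambda:\mathbb{S}^n\to\mathbb{R}^n$, $\lambda(A)=(\lambda_1(A),\dots,\lambda_n(A))^T$, be the map that sends $A$ to the vector of its eigenvalues (with multiplicity) in decreasing order $\lambda_1(A)\ge\dots\ge\lambda_n(A)$. Put $$K_n=\Big\{v\in\mathbb{R}^n \;\Big|\; \sum_{i=1}^k v_i\ge 0\ (k=1,\dots,n-1),\ \sum_{i=1}^n v_i=0\Big\}.$$ For a cone $K\subset\mathbb{R}^n$ let $K^\circ=\{w\in\mathbb{R}^n\mid \langle u,w\rangle\le 0 \text{ for all } u\in K\}$ be its polar cone, and call $K$ pointed if $K\cap(-K)=\{0\}$. Let $\mathrm{gph}\,\lambda=\{(A,\lambda(A))\mid A\in\mathbb{S}^n\}$ be the graph of $\lambda$ and let $\mathrm{Epi}_K\,\lambda=\{(A,y)\in\mathbb{S}^n\times\mathbb{R}^n\mid y-\lambda(A)\in K\}$ be its $K$-epigraph; $\lambda$ is called $K$-convex (respectively $K$-closed) if $\mathrm{Epi}_K\,\lambda$ is convex (respectively closed). Let $\overline{\mathrm{conv}}$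 denote the closed convex hull. Then: (a) $K_n$ is a closed, convex and pointed cone, and $K_n^\circ=\{w\in\mathbb{R}^n\mid w_1\le w_2\le\dots\le w_n\}$; equivalently, $-K_n^\circ=\{w\in\mathbb{R}^n\mid w_1\ge w_2\ge\dots\ge w_n\}$. (b) $\lambda$ is $K_n$-convex and $K_n$-closed. (c) The following are equivalent: (i) $K_n\subset -K_n^\circ$; (ii) $n\le 2$; (iii) $\mathrm{Epi}_{K_n}\lambda=\overline{\mathrm{conv}}(\mathrm{gph}\,\lambda)$. -/

import Mathlib

open scoped Pointwise

/-- A cone: a nonempty set that is stable under multiplication by nonnegative scalars. -/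
def IsCone {E : Type*} [AddCommGroup E] [Module ℝ E] (K : Set E) : Prop :=
  K.Nonempty ∧ ∀ c : ℝ, 0 ≤ c → ∀ x ∈ K, c • x ∈ K

/-- `K` is pointed: `K ∩ (-K) = {0}`. -/
def IsPointed {E : Type*} [AddCommGroup E] (K : Set E) : Prop :=
  K ∩ (-K) = {0}

/-- The polar cone `K° = {v | ⟨u, v⟩ ≤ 0 for all u ∈ K}`. -/
def polarCone {E : Type*} [NormedAddCommGroup E] [InnerProductSpace ℝ E] (K : Set E) : Set E :=
  {v | ∀ u ∈ K, inner ℝ u v ≤ 0}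

/-- The ordering induced by `K`: `x ≤_K y` if and only if `y - x ∈ K`. -/
def ConeLE {E : Type*} [AddCommGroup E] (K : Set E) (x y : E) : Prop :=
  y - x ∈ K

/-- The graph of `F`. -/
def gph {E₁ E₂ : Type*} (F : E₁ → E₂) : Set (E₁ × E₂) :=
  {p | p.2 = F p.1}

/-- The `K`-epigraph of `F`: all pairs `(x, y)` with `F x ≤_K y`. -/
def kEpi {E₁ E₂ : Type*} [AddCommGroup E₂] (K : Set E₂) (F : E₁ → E₂) : Set (E₁ × E₂) :=
  {p | ConeLE K (F p.1) p.2}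

/-- `F` is `K`-convex: its `K`-epigraph is convex. -/
def IsKConvex {E₁ E₂ : Type*} [AddCommGroup E₁] [Module ℝ E₁] [AddCommGroup E₂] [Module ℝ E₂]
    (K : Set E₂) (F : E₁ → E₂) : Prop :=
  Convex ℝ (kEpi K F)

/-- `F` is `K`-closed: its `K`-epigraph is closed. -/
def IsKClosed {E₁ E₂ : Type*} [TopologicalSpace E₁] [AddCommGroup E₂] [TopologicalSpace E₂]
    (K : Set E₂) (F : E₁ → E₂) : Prop :=
  IsClosed (kEpi K F)

/-- The real vector space of real symmetric `n × n` matrices. -/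
abbrev SymMat (n : ℕ) : Type :=
  selfAdjoint.submodule ℝ (Matrix (Fin n) (Fin n) ℝ)

theorem SymMat.isHermitian {n : ℕ} (A : SymMat n) :
    (A : Matrix (Fin n) (Fin n) ℝ).IsHermitian :=
  A.2

/-- The spectral map: the vector of the eigenvalues of `A`, with multiplicity, in decreasing
order. -/
noncomputable def spectralMap (n : ℕ) (A : SymMat n) : EuclideanSpace ℝ (Fin n) :=
  WithLp.toLp 2 fun i => A.isHermitian.eigenvalues₀ (Fin.cast (Fintype.card_fin n).symm i)

/-- The cone of all `v` with `v₁ + ⋯ + v_k ≥ 0` for `k = 1, …, n - 1` and `v₁ + ⋯ + v_n = 0`. -/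
def specCone (n : ℕ) : Set (EuclideanSpace ℝ (Fin n)) :=
  {v | (∀ k : ℕ, 1 ≤ k → k < n → 0 ≤ ∑ i : Fin n with i.val < k, v i) ∧ ∑ i : Fin n, v i = 0}

/-! By Schur and Ky Fan, `spectralMap n A` majorizes the diagonal of `A` in every orthonormal basis
`u`, with equality when `u` is an eigenbasis. So the epigraph is an intersection, over all `u`, of
preimages of the closed convex cone `specCone n` under the linear maps `(A, y) ↦ y - diagIn u A`
(`kEpi_spectralMap_eq_iInter`), which gives (b). The polar cone comes from Abel summation and the
vectors `e_i - e_j` with `i ≤ j`.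

For `n ≥ 3` the vector `e_1 - e_2` of the cone is not decreasing, and adding a large multiple of it
to a spectrum leaves the half-space `z_3 ≤ z_2` that contains the graph. For `n = 2` every point
`(A, z)` of the epigraph is the midpoint of two graph points `(A ± tB, z)` (`kEpi_two_subset`). For
`n ≤ 1` the cone is trivial. -/

/-! ### The cone and its polar. -/

open Finset in
theorem sum_lt_succ_eq {n : ℕ} (v : Fin n → ℝ) {k : ℕ} (h : k < n) :
    ∑ i : Fin n with i.val < k + 1, v i = (∑ i : Fin n with i.val < k, v i) + v ⟨k, h⟩ := by
  have : (univ.filter fun i : Fin n => i.val < k + 1) =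
      insert ⟨k, h⟩ (univ.filter fun i : Fin n => i.val < k) := by
    ext i
    simp only [mem_filter, mem_univ, true_and, mem_insert, Fin.ext_iff]
    omega
  rw [this, sum_insert (by simp), add_comm]

theorem sum_lt_of_le {n : ℕ} (v : Fin n → ℝ) {k : ℕ} (h : n ≤ k) :
    ∑ i : Fin n with i.val < k, v i = ∑ i, v i := by
  rw [Finset.filter_true_of_mem]
  exact fun i _ => i.2.trans_le h

theorem specCone_sum_nonneg {n : ℕ} {v : EuclideanSpace ℝ (Fin n)} (hv : v ∈ specCone n) (k : ℕ) :
    0 ≤ ∑ i : Fin n with i.val < k, v i := by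
  rcases Nat.eq_zero_or_pos k with rfl | hk
  · simp
  · rcases lt_or_ge k n with h | h
    · exact hv.1 k hk h
    · rw [sum_lt_of_le _ h, hv.2]

theorem zero_mem_specCone (n : ℕ) : (0 : EuclideanSpace ℝ (Fin n)) ∈ specCone n := by
  simp [specCone]

theorem smul_mem_specCone {n : ℕ} {c : ℝ} (hc : 0 ≤ c) {v : EuclideanSpace ℝ (Fin n)}
    (hv : v ∈ specCone n) : c • v ∈ specCone n := by
  refine ⟨fun k hk hkn => ?_, ?_⟩
  · simpa [← Finset.mul_sum] using mul_nonneg hc (hv.1 k hk hkn)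
  · simpa [← Finset.mul_sum] using Or.inr hv.2

theorem add_mem_specCone {n : ℕ} {v w : EuclideanSpace ℝ (Fin n)}
    (hv : v ∈ specCone n) (hw : w ∈ specCone n) : v + w ∈ specCone n := by
  refine ⟨fun k hk hkn => ?_, ?_⟩
  · simpa [Finset.sum_add_distrib] using add_nonneg (hv.1 k hk hkn) (hw.1 k hk hkn)
  · simp [Finset.sum_add_distrib, hv.2, hw.2]

theorem isCone_specCone (n : ℕ) : IsCone (specCone n) :=
  ⟨⟨0, zero_mem_specCone n⟩, fun _ hc _ hx => smul_mem_specCone hc hx⟩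

theorem convex_specCone (n : ℕ) : Convex ℝ (specCone n) := fun _ hx _ hy _ _ ha hb _ =>
  add_mem_specCone (smul_mem_specCone ha hx) (smul_mem_specCone hb hy)

theorem isClosed_specCone (n : ℕ) : IsClosed (specCone n) := by
  have h : specCone n = (⋂ k : ℕ, ⋂ _ : 1 ≤ k, ⋂ _ : k < n,
      {v : EuclideanSpace ℝ (Fin n) | 0 ≤ ∑ i : Fin n with i.val < k, v i}) ∩
      {v | ∑ i : Fin n, v i = 0} := by
    ext v
    simp [specCone]
  rw [h]
  refine IsClosed.inter (isClosed_iInter fun k => isClosed_iInter fun _ => isClosed_iInter fun _ =>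
    isClosed_le continuous_const (by fun_prop)) (isClosed_eq (by fun_prop) continuous_const)

theorem isPointed_specCone (n : ℕ) : IsPointed (specCone n) := by
  refine Set.Subset.antisymm (fun v hv => ?_) ?_
  · have h0 : ∀ k : ℕ, ∑ i : Fin n with i.val < k, v i = 0 := fun k => by
      have h1 := specCone_sum_nonneg hv.1 k
      have h2 := specCone_sum_nonneg hv.2 k
      simp only [PiLp.neg_apply, Finset.sum_neg_distrib] at h2
      linarith
    refine PiLp.ext fun i => ?_
    have := sum_lt_succ_eq v i.2
    rw [h0, h0] at this
    simpa using this.symm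
  · simp [zero_mem_specCone]

theorem single_sub_single_mem_specCone {n : ℕ} {i j : Fin n} (hij : i ≤ j) :
    EuclideanSpace.single i (1 : ℝ) - EuclideanSpace.single j 1 ∈ specCone n := by
  refine ⟨fun k _ _ => ?_, ?_⟩
  · simp only [PiLp.sub_apply, PiLp.single_apply, Finset.sum_sub_distrib, Finset.sum_ite_eq',
      Finset.mem_filter, Finset.mem_univ, true_and]
    have : i.val ≤ j.val := hij
    split_ifs <;> first | omega | norm_num
  · simp [PiLp.single_apply]

/-- Abel summation for a vector with nonnegative partial sums against a monotone vector. -/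
theorem sum_mul_nonpos_of_monotone {n : ℕ} {u : EuclideanSpace ℝ (Fin n)} (hu : u ∈ specCone n)
    {w : Fin n → ℝ} (hw : Monotone w) : ∑ i, w i * u i ≤ 0 := by
  -- Extension by `0` to `ℕ` makes summation by parts over `range n` available; only indices below
  -- `n` are ever evaluated.
  let f : ℕ → ℝ := fun k => if h : k < n then w ⟨k, h⟩ else 0
  let g : ℕ → ℝ := fun k => if h : k < n then u ⟨k, h⟩ else 0
  have hG : ∀ k ≤ n, ∑ i ∈ Finset.range k, g i = ∑ i : Fin n with i.val < k, u i := by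
    intro k hk
    induction k with
    | zero => simp
    | succ k ih =>
      have hkn : k < n := hk
      rw [Finset.sum_range_succ, ih hkn.le, sum_lt_succ_eq u hkn]
      simp [g, hkn]
  have hsum : ∑ i, w i * u i = ∑ i ∈ Finset.range n, f i • g i := by
    rw [← Fin.sum_univ_eq_sum_range (fun i => f i • g i)]
    simp [f, g]
  rw [hsum, Finset.sum_range_by_parts, hG n le_rfl, sum_lt_of_le _ le_rfl, hu.2, smul_zero,
    zero_sub, neg_nonpos]
  refine Finset.sum_nonneg fun i hi => ?_
  have hi' : i + 1 < n := by have := Finset.mem_range.1 hi; omega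
  have hi'' : i < n := by omega
  rw [hG _ hi'.le]
  refine mul_nonneg ?_ (specCone_sum_nonneg hu _)
  simp only [f, hi', hi'', dif_pos, sub_nonneg]
  exact hw (Fin.mk_le_mk.2 (Nat.le_succ i))

theorem polarCone_specCone (n : ℕ) :
    polarCone (specCone n) = {w | ∀ i j : Fin n, i ≤ j → w i ≤ w j} := by
  ext w
  refine ⟨fun hw i j hij => ?_, fun hw u hu => ?_⟩
  · have := hw _ (single_sub_single_mem_specCone hij)
    simp only [inner_sub_left, EuclideanSpace.inner_single_left, map_one, one_mul] at this
    linarith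
  · simpa [PiLp.inner_apply, RCLike.inner_apply] using
      sum_mul_nonpos_of_monotone hu (w := w) fun i j hij => hw i j hij

/-! ### Majorization and the epigraph. -/

theorem spectralMap_antitone {n : ℕ} (A : SymMat n) : Antitone (spectralMap n A) :=
  fun _ _ hij => A.isHermitian.eigenvalues₀_antitone hij

theorem exists_spectralMap_eq_eigenvalues {n : ℕ} (A : SymMat n) :
    ∃ e : Fin n ≃ Fin n, ∀ i, spectralMap n A i = A.isHermitian.eigenvalues (e i) :=
  ⟨(finCongr (Fintype.card_fin n).symm).trans (Fintype.equivOfCardEq (Fintype.card_fin _)),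
    fun i => by simp [spectralMap, Matrix.IsHermitian.eigenvalues]⟩

theorem sum_spectralMap {n : ℕ} (A : SymMat n) : ∑ i, spectralMap n A i = A.1.trace := by
  obtain ⟨e, he⟩ := exists_spectralMap_eq_eigenvalues A
  rw [A.isHermitian.trace_eq_sum_eigenvalues]
  simp only [he]
  exact e.sum_comp A.isHermitian.eigenvalues

theorem prod_spectralMap {n : ℕ} (A : SymMat n) : ∏ i, spectralMap n A i = A.1.det := by
  obtain ⟨e, he⟩ := exists_spectralMap_eq_eigenvalues A
  rw [A.isHermitian.det_eq_prod_eigenvalues]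
  simp only [he]
  exact e.prod_comp A.isHermitian.eigenvalues

theorem exists_orthonormalBasis_spectralMap {n : ℕ} (A : SymMat n) :
    ∃ v : OrthonormalBasis (Fin n) ℝ (EuclideanSpace ℝ (Fin n)),
      ∀ i, Matrix.toEuclideanLin A.1 (v i) = spectralMap n A i • v i := by
  obtain ⟨e, he⟩ := exists_spectralMap_eq_eigenvalues A
  refine ⟨A.isHermitian.eigenvectorBasis.reindex e.symm, fun i => ?_⟩
  rw [he, OrthonormalBasis.reindex_apply, Equiv.symm_symm]
  refine (WithLp.ofLp_injective 2) ?_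
  exact A.isHermitian.mulVec_eigenvectorBasis (e i)

/-- The diagonal of a symmetric matrix in the orthonormal basis `u`. -/
noncomputable def diagIn {n : ℕ} (u : OrthonormalBasis (Fin n) ℝ (EuclideanSpace ℝ (Fin n))) :
    SymMat n →ₗ[ℝ] EuclideanSpace ℝ (Fin n) where
  toFun A := WithLp.toLp 2 fun i => inner ℝ (u i) (Matrix.toEuclideanLin A.1 (u i))
  map_add' A B := by
    ext i
    simp [inner_add_right]
  map_smul' c A := by
    ext i
    simp [inner_smul_right]

theorem diagIn_apply_eq_sum {n : ℕ} (u v : OrthonormalBasis (Fin n) ℝ (EuclideanSpace ℝ (Fin n)))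
    (A : SymMat n) (hv : ∀ i, Matrix.toEuclideanLin A.1 (v i) = spectralMap n A i • v i)
    (i : Fin n) : diagIn u A i = ∑ j, spectralMap n A j * inner ℝ (v j) (u i) ^ 2 := by
  change inner ℝ (u i) (Matrix.toEuclideanLin A.1 (u i)) = _
  rw [← v.sum_inner_mul_inner]
  refine Finset.sum_congr rfl fun j _ => ?_
  have hs := Matrix.isSymmetric_toEuclideanLin_iff.mpr A.isHermitian
  rw [← hs (v j) (u i), hv, inner_smul_left, real_inner_comm (v j) (u i)]
  simp only [conj_trivial]
  ring

/-- The inequalities of Schur and Ky Fan. -/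
theorem spectralMap_sub_diagIn_mem {n : ℕ}
    (u : OrthonormalBasis (Fin n) ℝ (EuclideanSpace ℝ (Fin n))) (A : SymMat n) :
    spectralMap n A - diagIn u A ∈ specCone n := by
  obtain ⟨v, hv⟩ := exists_orthonormalBasis_spectralMap A
  -- The squared inner products of the two bases form a doubly stochastic matrix.
  have hcol : ∀ j, ∑ i, inner ℝ (v j) (u i) ^ 2 = 1 := fun j => by
    simpa using u.sum_sq_norm_inner_left (v j)
  have hrow : ∀ i, ∑ j, inner ℝ (v j) (u i) ^ 2 = 1 := fun i => by
    simpa using v.sum_sq_norm_inner_right (u i)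
  have hswap : ∀ s : Finset (Fin n), ∑ i ∈ s, diagIn u A i =
      ∑ j, spectralMap n A j * ∑ i ∈ s, inner ℝ (v j) (u i) ^ 2 := fun s => by
    simp only [diagIn_apply_eq_sum u v A hv, Finset.mul_sum]
    exact Finset.sum_comm
  refine ⟨fun k hk hkn => ?_, ?_⟩
  · simp only [PiLp.sub_apply, Finset.sum_sub_distrib, hswap]
    set s : Finset (Fin n) := Finset.univ.filter fun i => i.val < k
    set l := spectralMap n A
    set c : Fin n → ℝ := fun j => ∑ i ∈ s, inner ℝ (v j) (u i) ^ 2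
    let p : Fin n := ⟨k, hkn⟩
    have hc0 : ∀ j, 0 ≤ c j := fun j => Finset.sum_nonneg fun _ _ => sq_nonneg _
    have hc1 : ∀ j, c j ≤ 1 := fun j => by
      rw [← hcol j]
      exact Finset.sum_le_sum_of_subset_of_nonneg (Finset.subset_univ s)
        fun _ _ _ => sq_nonneg _
    have hcs : ∑ j, c j = ∑ j, if j ∈ s then (1 : ℝ) else 0 := by
      rw [Finset.sum_comm]
      simp [hrow]
    have hl : ∑ i ∈ s, l i = ∑ j, l j * if j ∈ s then 1 else 0 := by
      simp
    -- `p` is the first index outside `s`, so both factors have the same sign. Subtracting `l p`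
    -- costs nothing because `c` and the indicator of `s` have equal sums.
    have key : 0 ≤ ∑ j, (l j - l p) * ((if j ∈ s then 1 else 0) - c j) := by
      refine Finset.sum_nonneg fun j _ => ?_
      by_cases hj : j ∈ s
      · have hjk : j.val < k := (Finset.mem_filter.1 hj).2
        rw [if_pos hj]
        exact mul_nonneg (sub_nonneg.2 (spectralMap_antitone A (Fin.le_def.2 hjk.le)))
          (sub_nonneg.2 (hc1 j))
      · have hjk : k ≤ j.val := by simpa [s] using hj
        rw [if_neg hj]
        exact mul_nonneg_of_nonpos_of_nonpos
          (sub_nonpos.2 (spectralMap_antitone A (Fin.le_def.2 hjk)))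
          (by linarith [hc0 j])
    have expand : ∑ j, (l j - l p) * ((if j ∈ s then 1 else 0) - c j) =
        (∑ j, l j * (if j ∈ s then 1 else 0) - ∑ j, l j * c j) -
          l p * ((∑ j, if j ∈ s then (1 : ℝ) else 0) - ∑ j, c j) := by
      rw [← Finset.sum_sub_distrib, ← Finset.sum_sub_distrib, Finset.mul_sum,
        ← Finset.sum_sub_distrib]
      exact Finset.sum_congr rfl fun j _ => by ring
    rw [expand, hcs, sub_self, mul_zero, sub_zero] at key
    rwa [hl]
  · simp only [PiLp.sub_apply, Finset.sum_sub_distrib, hswap, hcol, mul_one, sub_self]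

theorem kEpi_spectralMap_eq_iInter (n : ℕ) :
    kEpi (specCone n) (spectralMap n) =
      ⋂ u, ((LinearMap.snd ℝ (SymMat n) (EuclideanSpace ℝ (Fin n)) -
        diagIn u ∘ₗ LinearMap.fst ℝ (SymMat n) (EuclideanSpace ℝ (Fin n))) ⁻¹' specCone n) := by
  ext ⟨A, y⟩
  simp only [Set.mem_iInter, Set.mem_preimage, LinearMap.sub_apply, LinearMap.snd_apply,
    LinearMap.comp_apply, LinearMap.fst_apply]
  refine ⟨fun h u => ?_, fun h => ?_⟩
  · have := add_mem_specCone (v := y - spectralMap n A) h (spectralMap_sub_diagIn_mem u A)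
    rwa [sub_add_sub_cancel] at this
  · obtain ⟨v, hv⟩ := exists_orthonormalBasis_spectralMap A
    have hd : diagIn v A = spectralMap n A := by
      ext i
      change inner ℝ (v i) (Matrix.toEuclideanLin A.1 (v i)) = _
      rw [hv, inner_smul_right, real_inner_self_eq_norm_sq, v.norm_eq_one]
      simp
    have := h v
    rwa [hd] at this

theorem isKConvex_spectralMap (n : ℕ) : IsKConvex (specCone n) (spectralMap n) := by
  unfold IsKConvex
  rw [kEpi_spectralMap_eq_iInter]
  exact convex_iInter fun u => (convex_specCone n).linear_preimage _

theorem isKClosed_spectralMap (n : ℕ) : IsKClosed (specCone n) (spectralMap n) := by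
  unfold IsKClosed
  rw [kEpi_spectralMap_eq_iInter]
  refine isClosed_iInter fun u => (isClosed_specCone n).preimage ?_
  exact continuous_snd.sub
    ((LinearMap.continuous_of_finiteDimensional (diagIn u)).comp continuous_fst)

theorem closedConvexHull_gph_subset_kEpi (n : ℕ) :
    closedConvexHull ℝ (gph (spectralMap n)) ⊆ kEpi (specCone n) (spectralMap n) := by
  refine closedConvexHull_min (fun p hp => ?_) (isKConvex_spectralMap n) (isKClosed_spectralMap n)
  have hp' : p.2 = spectralMap n p.1 := hp
  change p.2 - spectralMap n p.1 ∈ specCone n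
  rw [hp', sub_self]
  exact zero_mem_specCone n

/-! ### The threshold `n ≤ 2`. -/

theorem le_two_of_specCone_subset {n : ℕ} (h : specCone n ⊆ -polarCone (specCone n)) :
    n ≤ 2 := by
  by_contra! hn
  let a : Fin n := ⟨0, by omega⟩
  let b : Fin n := ⟨1, by omega⟩
  let c : Fin n := ⟨2, hn⟩
  have hab : a ≤ b := Fin.le_def.2 (by simp [a, b])
  have hbc : b ≤ c := Fin.le_def.2 (by simp [b, c])
  -- The entries `1, -1, 0` at `a, b, c` are not decreasing.
  have h1 := h (single_sub_single_mem_specCone hab)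
  rw [polarCone_specCone] at h1
  have h2 := h1 b c hbc
  simp [a, b, c] at h2
  norm_num at h2

theorem specCone_subset_of_le_two {n : ℕ} (hn : n ≤ 2) :
    specCone n ⊆ -polarCone (specCone n) := by
  intro v hv
  rw [polarCone_specCone]
  intro i j hij
  interval_cases n
  · exact i.elim0
  · rw [Subsingleton.elim i j]
  · have h0 := specCone_sum_nonneg hv 1
    have h1 := hv.2
    rw [sum_lt_succ_eq v (by norm_num : 0 < 2)] at h0
    simp only [Fin.sum_univ_two] at h1
    simp at h0
    fin_cases i <;> fin_cases j <;> simp_all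
    linarith

/-- On the graph `λ₂ ≥ λ₃`, but not on the whole epigraph. -/
theorem le_two_of_kEpi_eq {n : ℕ}
    (h : kEpi (specCone n) (spectralMap n) = closedConvexHull ℝ (gph (spectralMap n))) :
    n ≤ 2 := by
  by_contra! hn
  let a : Fin n := ⟨0, by omega⟩
  let b : Fin n := ⟨1, by omega⟩
  let c : Fin n := ⟨2, hn⟩
  have hab : a ≤ b := Fin.le_def.2 (by simp [a, b])
  have hbc : b ≤ c := Fin.le_def.2 (by simp [b, c])
  let l := spectralMap n 0
  have hl : l c ≤ l b := spectralMap_antitone 0 hbc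
  -- The coefficient makes `y b = l c - 1`, just below `y c = l c`.
  let y := l + (l b - l c + 1) • (EuclideanSpace.single a (1 : ℝ) - EuclideanSpace.single b 1)
  have hy : ((0 : SymMat n), y) ∈ kEpi (specCone n) (spectralMap n) := by
    change y - l ∈ specCone n
    rw [add_sub_cancel_left]
    exact smul_mem_specCone (by linarith) (single_sub_single_mem_specCone hab)
  let H : Set (SymMat n × EuclideanSpace ℝ (Fin n)) := {p | p.2 c ≤ p.2 b}
  have hH : closedConvexHull ℝ (gph (spectralMap n)) ⊆ H := by
    refine closedConvexHull_min ?_ ?_ ?_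
    · rintro ⟨A, z⟩ (rfl : z = spectralMap n A)
      exact spectralMap_antitone A hbc
    · intro p hp q hq s t hs ht _
      change s * p.2 c + t * q.2 c ≤ s * p.2 b + t * q.2 b
      exact add_le_add (mul_le_mul_of_nonneg_left hp hs) (mul_le_mul_of_nonneg_left hq ht)
    · exact isClosed_le (by fun_prop) (by fun_prop)
  rw [h] at hy
  have h1 : y c ≤ y b := hH hy
  simp [y, a, b, c] at h1
  linarith

/-! ### Two by two matrices. -/

theorem spectralMap_two_eq {A : SymMat 2} {m s : ℝ} (hs : 0 ≤ s) (htr : A.1.trace = 2 * m)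
    (hdet : A.1.det = m ^ 2 - s ^ 2) : spectralMap 2 A 0 = m + s ∧ spectralMap 2 A 1 = m - s := by
  have h1 := sum_spectralMap A
  have h2 := prod_spectralMap A
  have h3 : spectralMap 2 A 1 ≤ spectralMap 2 A 0 := spectralMap_antitone A (by decide)
  rw [Fin.sum_univ_two, htr] at h1
  rw [Fin.prod_univ_two, hdet] at h2
  have h4 : (spectralMap 2 A 0 - m) ^ 2 = s ^ 2 := by
    have : spectralMap 2 A 1 = 2 * m - spectralMap 2 A 0 := by linarith
    rw [this] at h2
    linarith
  have h5 : spectralMap 2 A 0 - m = s := by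
    rwa [sq_eq_sq₀ (by linarith) hs] at h4
  constructor <;> linarith

/-- Supplies the direction `B = [[x, y], [y, -x]]`, orthogonal to the traceless part `[[d, q], [q,
-d]]` of `A`. -/
theorem exists_unit_orthogonal (d q : ℝ) : ∃ x y : ℝ, d * x + q * y = 0 ∧ x ^ 2 + y ^ 2 = 1 := by
  by_cases h : d ^ 2 + q ^ 2 = 0
  · have hd : d = 0 := by nlinarith [sq_nonneg d, sq_nonneg q]
    have hq : q = 0 := by nlinarith [sq_nonneg d, sq_nonneg q]
    exact ⟨1, 0, by simp [hd], by simp⟩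
  · have hp : 0 < d ^ 2 + q ^ 2 := lt_of_le_of_ne (by positivity) (Ne.symm h)
    have hr := Real.sq_sqrt hp.le
    have hr0 := (Real.sqrt_pos.2 hp).ne'
    refine ⟨-q / √(d ^ 2 + q ^ 2), d / √(d ^ 2 + q ^ 2), by ring, ?_⟩
    rw [div_pow, div_pow, hr]
    field_simp
    ring

/-- The symmetric matrix `[[a, b], [b, c]]`. -/
def symMatTwo (a b c : ℝ) : SymMat 2 :=
  ⟨!![a, b; b, c], by
    change star _ = _
    ext i j
    fin_cases i <;> fin_cases j <;> simp [Matrix.star_apply]⟩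

theorem kEpi_two_subset :
    kEpi (specCone 2) (spectralMap 2) ⊆ closedConvexHull ℝ (gph (spectralMap 2)) := by
  rintro ⟨A, z⟩ hz
  have hsym : A.1 1 0 = A.1 0 1 := by simpa using A.isHermitian.apply 0 1
  obtain ⟨m, d, q, rfl⟩ : ∃ m d q, A = symMatTwo (m + d) q (m - d) := by
    refine ⟨(A.1 0 0 + A.1 1 1) / 2, (A.1 0 0 - A.1 1 1) / 2, A.1 0 1, Subtype.ext ?_⟩
    ext i j
    fin_cases i <;> fin_cases j <;> simp [symMatTwo, hsym] <;> ring
  set r := √(d ^ 2 + q ^ 2) with hr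
  have hr2 : r ^ 2 = d ^ 2 + q ^ 2 := Real.sq_sqrt (by positivity)
  have hr0 : 0 ≤ r := Real.sqrt_nonneg _
  obtain ⟨e0, e1⟩ := spectralMap_two_eq (A := symMatTwo (m + d) q (m - d)) (m := m) hr0
    (by simp [symMatTwo, Matrix.trace_fin_two]; ring)
    (by simp only [symMatTwo, Matrix.det_fin_two_of]; rw [hr2]; ring)
  have hz' : z - spectralMap 2 (symMatTwo (m + d) q (m - d)) ∈ specCone 2 := hz
  have hz0 := specCone_sum_nonneg hz' 1
  have hz1 := hz'.2
  rw [sum_lt_succ_eq _ (by norm_num : 0 < 2)] at hz0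
  simp only [Fin.sum_univ_two, PiLp.sub_apply, e0, e1] at hz1
  simp [e0] at hz0
  have hs0 : 0 ≤ z 0 - m := by linarith
  obtain ⟨x, y, hxy, hxy1⟩ := exists_unit_orthogonal d q
  -- By Pythagoras, moving by `±t` along `B` enlarges the half-gap between the eigenvalues from `r`
  -- to `z 0 - m`, which is at least `r` by `hz0`.
  set t := √((z 0 - m) ^ 2 - r ^ 2) with ht
  have ht2 : t ^ 2 = (z 0 - m) ^ 2 - r ^ 2 := Real.sq_sqrt (by nlinarith)
  have main : ∀ e : ℝ, e ^ 2 = 1 →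
      (symMatTwo (m + d + e * t * x) (q + e * t * y) (m - d - e * t * x), z) ∈
        gph (spectralMap 2) := by
    intro e he
    obtain ⟨f0, f1⟩ := spectralMap_two_eq
      (A := symMatTwo (m + d + e * t * x) (q + e * t * y) (m - d - e * t * x)) (m := m) hs0
      (by simp [symMatTwo, Matrix.trace_fin_two]; ring)
      (by
        simp only [symMatTwo, Matrix.det_fin_two_of]
        linear_combination (-2 * e * t) * hxy - e ^ 2 * t ^ 2 * hxy1 - t ^ 2 * he - ht2 + hr2)
    refine PiLp.ext fun i => ?_
    fin_cases i
    · change z 0 = spectralMap 2 _ 0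
      rw [f0]; ring
    · change z 1 = spectralMap 2 _ 1
      rw [f1]; linarith
  have hc := convex_closedConvexHull (𝕜 := ℝ) (s := gph (spectralMap 2))
    (subset_closedConvexHull (main 1 (by norm_num)))
    (subset_closedConvexHull (main (-1) (by norm_num)))
    (by norm_num : (0 : ℝ) ≤ 1 / 2) (by norm_num : (0 : ℝ) ≤ 1 / 2) (by norm_num)
  convert hc using 1
  refine Prod.ext (Subtype.ext ?_) ?_
  · ext i j
    fin_cases i <;> fin_cases j <;> simp [symMatTwo] <;> ring
  · refine PiLp.ext fun i => ?_
    simp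
    ring

theorem kEpi_eq_of_le_two {n : ℕ} (hn : n ≤ 2) :
    kEpi (specCone n) (spectralMap n) = closedConvexHull ℝ (gph (spectralMap n)) := by
  refine Set.Subset.antisymm ?_ (closedConvexHull_gph_subset_kEpi n)
  rcases hn.lt_or_eq with h | rfl
  · rintro ⟨A, z⟩ hz
    refine subset_closedConvexHull ?_
    have hz' : z - spectralMap n A ∈ specCone n := hz
    have h0 := hz'.2
    refine PiLp.ext fun i => ?_
    -- With at most one coordinate, the zero-sum condition forces `z = spectralMap n A`.
    have : Subsingleton (Fin n) := Fin.subsingleton_iff_le_one.2 (by omega)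
    rw [Fintype.sum_subsingleton _ i] at h0
    exact sub_eq_zero.1 h0
  · exact kEpi_two_subset

theorem mainTheorem9 (n : ℕ) :
    (IsCone (specCone n) ∧ IsClosed (specCone n) ∧ Convex ℝ (specCone n) ∧
        IsPointed (specCone n) ∧
        polarCone (specCone n) = {w | ∀ i j : Fin n, i ≤ j → w i ≤ w j}) ∧
      (IsKConvex (specCone n) (spectralMap n) ∧ IsKClosed (specCone n) (spectralMap n)) ∧
      ((specCone n ⊆ -polarCone (specCone n) ↔ n ≤ 2) ∧
        (n ≤ 2 ↔
          kEpi (specCone n) (spectralMap n) = closedConvexHull ℝ (gph (spectralMap n)))) :=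
  ⟨⟨isCone_specCone n, isClosed_specCone n, convex_specCone n, isPointed_specCone n,
      polarCone_specCone n⟩,
    ⟨isKConvex_spectralMap n, isKClosed_spectralMap n⟩,
    ⟨le_two_of_specCone_subset, specCone_subset_of_le_two⟩, ⟨kEpi_eq_of_le_two, le_two_of_kEpi_eq⟩⟩
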